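/- **Proposition.** Let $k$ be an algebraically closed field of characteristic $0$, and let $X\subseteq\mathbb{A}^m_k$ and $Y\subseteq\mathbb{A}^n_k$ be affine varieties, that is, irreducible Zariski closed subsets. Let $A(X)$ and $A(Y)$ denote their coordinate rings, viewed as the $k$-algebras of regular (polynomial) functions on $X$ and $Y$, and assume that $Y$ is factorial, i.e. that $A(Y)$ is a unique factorization domain. Let $\Phi\colon X\to Y$ be a regular map, i.e. a map whose $n$ coordinate functions belong to $A(X)$, and assume that $\Phi$ is almost surjective, i.e. $$\dim\overline{Y\setminus\Phi(X)}\le\dim Y-2,$$ where the bar denotes Zariski closure and $\dim\emptyset=-\infty$. Let $$A\langle\Phi\rangle=\{g\in A(X) : g=h\circ\Phi \text{ for some function } h\colon Y\to k,\ \text{not necessarily regular}\},$$ $$A[\Phi]=\{p\circ\Phi : p\in A(Y)\},$$ which are $k$-subalgebras of $A(X)$. Then $A\langle\Phi\rangle=A[\Phi]$. -/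

import Mathlib

/-- The set of points of affine `n`-space over `k`, as a type of its own so that it can carry the
Zariski topology. -/
def AffSpace (k : Type*) (n : ℕ) : Type _ := Fin n → k

namespace AffSpace

variable {k : Type*} [Field k] {n : ℕ}

/-- The algebraic set cut out by a set of polynomials. -/
def zeroSet (S : Set (MvPolynomial (Fin n) k)) : Set (AffSpace k n) :=
  {x | ∀ p ∈ S, MvPolynomial.eval x p = 0}

/-- The Zariski topology: the closed sets are the algebraic sets. -/
instance zariskiTopology : TopologicalSpace (AffSpace k n) :=
  TopologicalSpace.ofClosed {V | ∃ S : Set (MvPolynomial (Fin n) k), V = zeroSet S}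
    ⟨{1}, by ext x; simp [zeroSet]⟩
    (by
      intro A hA
      refine ⟨{p | ∃ S : Set (MvPolynomial (Fin n) k), zeroSet S ∈ A ∧ p ∈ S}, ?_⟩
      ext x
      constructor
      · rintro hx p ⟨S, hS, hp⟩
        exact hx _ hS p hp
      · intro hx V hV
        obtain ⟨S, rfl⟩ := hA hV
        exact fun p hp => hx p ⟨S, hV, hp⟩)
    (by
      rintro _ ⟨S, rfl⟩ _ ⟨T, rfl⟩
      refine ⟨{r | ∃ p ∈ S, ∃ q ∈ T, r = p * q}, ?_⟩
      ext x
      constructor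
      · rintro (hx | hx) r ⟨p, hp, q, hq, rfl⟩
        · simp [hx p hp]
        · simp [hx q hq]
      · intro hx
        by_contra hcon
        simp only [Set.mem_union, not_or, zeroSet, Set.mem_ofPred_eq, not_forall] at hcon
        obtain ⟨⟨p, hp, hp0⟩, ⟨q, hq, hq0⟩⟩ := hcon
        have := hx (p * q) ⟨p, hp, q, hq, rfl⟩
        rw [map_mul] at this
        exact (mul_ne_zero hp0 hq0) this)

end AffSpace

/-- An affine variety in affine `n`-space: an irreducible (in particular nonempty) Zariski closed
subset. -/
structure AffineVariety (k : Type*) [Field k] (n : ℕ) where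
  carrier : Set (AffSpace k n)
  isClosed_carrier : IsClosed carrier
  isIrreducible_carrier : IsIrreducible carrier

namespace AffineVariety

variable {k : Type*} [Field k] {m n : ℕ}

/-- The points of an affine variety, with the subspace (Zariski) topology. -/
abbrev Point (X : AffineVariety k n) : Type _ := ↥X.carrier

/-- The `i`-th coordinate function on `X`. -/
def coord (X : AffineVariety k n) (i : Fin n) : X.Point → k := fun x => x.1 i

/-- The coordinate ring `A(X)`, as the algebra of regular functions on `X`, that is, of the
functions `X → k` which are given by polynomials in the coordinates. -/
noncomputable def coordinateRing (X : AffineVariety k n) : Subalgebra k (X.Point → k) :=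
  (MvPolynomial.aeval X.coord : MvPolynomial (Fin n) k →ₐ[k] (X.Point → k)).range

/-- `X` is factorial if its coordinate ring is a unique factorization domain. -/
def IsFactorial (X : AffineVariety k n) : Prop :=
  IsDomain X.coordinateRing ∧ UniqueFactorizationMonoid X.coordinateRing

/-- A regular map `X → Y`: a map each of whose coordinates is a regular function on `X`. -/
structure RegularMap (X : AffineVariety k m) (Y : AffineVariety k n) where
  toFun : X.Point → Y.Point
  coord_mem : ∀ i : Fin n, Y.coord i ∘ toFun ∈ X.coordinateRing

namespace RegularMap

variable {X : AffineVariety k m} {Y : AffineVariety k n}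

theorem comp_mem (Φ : RegularMap X Y) (f : Y.coordinateRing) :
    f.1 ∘ Φ.toFun ∈ X.coordinateRing := by
  obtain ⟨_, p, rfl⟩ := f
  induction p using MvPolynomial.induction_on with
  | C a =>
    have h : (MvPolynomial.aeval Y.coord (MvPolynomial.C a : MvPolynomial (Fin n) k)) ∘ Φ.toFun
        = algebraMap k (X.Point → k) a := by
      rw [MvPolynomial.aeval_C]; rfl
    exact h ▸ X.coordinateRing.algebraMap_mem a
  | add p q hp hq =>
    have h := X.coordinateRing.add_mem hp hq
    simpa [Pi.add_comp] using h
  | mul_X p i hp =>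
    have h := X.coordinateRing.mul_mem hp (Φ.coord_mem i)
    simpa [Pi.mul_comp] using h

/-- The `k`-algebra homomorphism `Φ^* : A(Y) → A(X)`, `f ↦ f ∘ Φ`. -/
noncomputable def pullback (Φ : RegularMap X Y) : Y.coordinateRing →ₐ[k] X.coordinateRing where
  toFun f := ⟨f.1 ∘ Φ.toFun, Φ.comp_mem f⟩
  map_one' := rfl
  map_mul' _ _ := rfl
  map_zero' := rfl
  map_add' _ _ := rfl
  commutes' _ := rfl

/-- `A[Φ]`: the image of `Φ^*` in `A(X)`. -/
noncomputable def pullbackSubalgebra (Φ : RegularMap X Y) : Subalgebra k X.coordinateRing :=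
  Φ.pullback.range

/-- `A⟨Φ⟩`: the regular functions `g` on `X` that are determined by `Φ`, that is, `g = h ∘ Φ` for
some function `h : Y → k`, not necessarily regular. -/
def determinedSubalgebra (Φ : RegularMap X Y) : Subalgebra k X.coordinateRing where
  carrier := {g | ∃ h : Y.Point → k, h ∘ Φ.toFun = g.1}
  mul_mem' := by
    rintro a b ⟨h, hh⟩ ⟨h', hh'⟩
    exact ⟨h * h', by rw [Pi.mul_comp, hh, hh']; rfl⟩
  add_mem' := by
    rintro a b ⟨h, hh⟩ ⟨h', hh'⟩
    exact ⟨h + h', by rw [Pi.add_comp, hh, hh']; rfl⟩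
  algebraMap_mem' c := ⟨fun _ => c, rfl⟩

/-- `Φ` is almost surjective if the Zariski closure in `Y` of the complement of its image has
dimension at most `dim Y - 2`. The dimension of the empty set is `⊥`, so that a surjective map is
almost surjective whatever `dim Y` is. -/
def IsAlmostSurjective (Φ : RegularMap X Y) : Prop :=
  topologicalKrullDim (closure ((Set.range Φ.toFun)ᶜ) : Set Y.Point) + 2
    ≤ topologicalKrullDim Y.Point

end RegularMap

end AffineVariety

/-!
The inclusion `A[Φ] ⊆ A⟨Φ⟩` is immediate. For the other one write `B = A(Y)`, `A = A(X)` and let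
`g = h ∘ Φ` be regular on `X`. Almost surjectivity enters only through one consequence: for an
ideal `I` of `B` with `dim B ≤ dim B/I + 1`, the zero set of `I` is not contained in the closure
of the complement of the image (`IsAlmostSurjective.not_zeros_subset`). With `I = 0` this gives that
`Φ^* : B → A` is injective.

*`g` is a fraction.* The `k`-points of `A ⊗_B A` are the pairs `(x₁, x₂)` with `Φ x₁ = Φ x₂`, and
on these `g ⊗ 1 - 1 ⊗ g` vanishes since `g` factors through `Φ`; by the Nullstellensatz
`g ⊗ 1 - 1 ⊗ g` is nilpotent. Pass to `L ⊗_K L` for the fraction fields `K ⊆ L` of `B ⊆ A`. If `g`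
were transcendental over `K`, then `X ⊗ 1 - 1 ⊗ X` would be nilpotent in `K[X] ⊗ K[X]`, which is
absurd. So `g` is algebraic, hence separable in characteristic zero, and `K(g) ⊗ K(g)` is reduced.
Therefore `g ⊗ 1 = 1 ⊗ g`, which means `g ∈ K` (`mem_range_of_isNilpotent_tmul_sub`).

*The denominator is a unit.* As `B` is factorial, `g = p / q` with `p`, `q` coprime. If a prime `π`
divided `q`, then `p = q g` would vanish at the points of `V(π)` in the image of `Φ`, so the
irreducible set `V(π)` would be covered by `V(p)` and the closure of the complement of the image. The
latter cannot contain `V(π)`, because `dim B/π ≥ dim B - 1`; so `p` vanishes on `V(π)`, and `π ∣ p`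
by the Nullstellensatz, against coprimality (`IsAlmostSurjective.dvd_of_forall_range`).

The inequality `dim B ≤ dim B/(b) + 1` for a nonunit `b` of an affine domain follows from Krull's
height theorem once every maximal ideal of `B` is known to have height `dim B`
(`Ideal.height_eq_ringKrullDim_of_isMaximal`); this comes from the polynomial ring by Noether
normalization and going down.
-/

open TensorProduct

/-! ### Field theory: nilpotence of `x ⊗ 1 - 1 ⊗ x` -/

theorem mem_range_of_tmul_one_eq_one_tmul {K L : Type*} [Field K] [Field L] [Algebra K L] {x : L}
    (h : x ⊗ₜ[K] (1 : L) = 1 ⊗ₜ[K] x) : x ∈ (algebraMap K L).range := by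
  by_contra hx
  have hx' : x ∉ Submodule.span K {(1 : L)} := fun hmem => by
    obtain ⟨a, ha⟩ := Submodule.mem_span_singleton.mp hmem
    exact hx ⟨a, by rw [← ha, Algebra.smul_def, mul_one]⟩
  obtain ⟨f, hfx, hf⟩ := Submodule.exists_le_ker_of_notMem hx'
  have hf1 : f 1 = 0 := hf (Submodule.mem_span_singleton_self 1)
  have := congrArg (TensorProduct.lid K L ∘ LinearMap.rTensor L f) h
  simp [hf1, hfx] at this

/-- A finite separable extension `F / K` is unramified, hence so is its base change `F ⊗ F` over
`F`, and an unramified algebra over a field is reduced. -/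
theorem isReduced_tensorProduct_self_of_isSeparable (K F : Type*) [Field K] [Field F] [Algebra K F]
    [FiniteDimensional K F] [Algebra.IsSeparable K F] : IsReduced (F ⊗[K] F) := by
  have := Algebra.FormallyUnramified.of_isSeparable K F
  exact Algebra.FormallyUnramified.isReduced_of_field F (F ⊗[K] F)

theorem not_isNilpotent_of_transcendental {K L : Type*} [Field K] [Field L] [Algebra K L] {x : L}
    (hx : Transcendental K x) : ¬ IsNilpotent (x ⊗ₜ[K] (1 : L) - 1 ⊗ₜ[K] x) := by
  intro hnil
  let f : Polynomial K →ₐ[K] L := Polynomial.aeval x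
  have hf : Function.Injective f := transcendental_iff_injective.mp hx
  let F := Algebra.TensorProduct.map f f
  have hF : Function.Injective F :=
    TensorProduct.map_injective_of_flat_flat f.toLinearMap f.toLinearMap hf hf
  have h1 : IsNilpotent ((Polynomial.X : Polynomial K) ⊗ₜ[K] (1 : Polynomial K) -
      (1 : Polynomial K) ⊗ₜ[K] (Polynomial.X : Polynomial K)) := by
    rw [← IsNilpotent.map_iff hF]
    simpa [F, f] using hnil
  -- Evaluating the two variables at `0` and `1` turns `X ⊗ 1 - 1 ⊗ X` into the unit `-1`.
  let ev : Polynomial K ⊗[K] Polynomial K →ₐ[K] K :=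
    Algebra.TensorProduct.productMap (Polynomial.aeval 0) (Polynomial.aeval 1)
  have h2 := h1.map ev
  simp [ev] at h2

/-- In characteristic zero, an element of an extension field `L / K` whose two images in `L ⊗ L`
agree up to a nilpotent lies in `K`. -/
theorem mem_range_of_isNilpotent_tmul_sub {K L : Type*} [Field K] [CharZero K] [Field L]
    [Algebra K L] {x : L} (hx : IsNilpotent (x ⊗ₜ[K] (1 : L) - 1 ⊗ₜ[K] x)) :
    x ∈ (algebraMap K L).range := by
  by_cases hal : Transcendental K x
  · exact absurd hx (not_isNilpotent_of_transcendental hal)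
  have hint : IsIntegral K x := (not_not.mp hal).isIntegral
  let F := IntermediateField.adjoin K {x}
  have : FiniteDimensional K F := IntermediateField.adjoin.finiteDimensional hint
  have := isReduced_tensorProduct_self_of_isSeparable K F
  let y : F := IntermediateField.AdjoinSimple.gen K x
  let G := Algebra.TensorProduct.map F.val F.val
  have hG : Function.Injective G :=
    TensorProduct.map_injective_of_flat_flat F.val.toLinearMap F.val.toLinearMap
      F.val.injective F.val.injective
  have h1 : IsNilpotent (y ⊗ₜ[K] (1 : F) - 1 ⊗ₜ[K] y) := by
    rw [← IsNilpotent.map_iff hG]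
    simpa [G, y] using hx
  obtain ⟨a, ha⟩ := mem_range_of_tmul_one_eq_one_tmul (sub_eq_zero.mp h1.eq_zero)
  exact ⟨a, by simpa [y] using congrArg F.val ha⟩

/-! ### Nullstellensatz for algebras of finite type -/

section Nullstellensatz

variable (k : Type*) [Field k] [IsAlgClosed k] {R : Type*} [CommRing R] [Algebra k R]
  [Algebra.FiniteType k R]

/-- Weak Nullstellensatz: the maximal ideals of a `k`-algebra of finite type are the kernels of its
`k`-valued points. -/
theorem exists_algHom_of_isMaximal (M : Ideal R) [M.IsMaximal] :
    ∃ χ : R →ₐ[k] k, RingHom.ker χ = M := by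
  let := Ideal.Quotient.field M
  have := finite_of_finite_type_of_isJacobsonRing k (R ⧸ M)
  let e : (R ⧸ M) →ₐ[k] k := IsAlgClosed.lift
  refine ⟨e.comp (Ideal.Quotient.mkₐ k M), ?_⟩
  ext r
  simp [RingHom.mem_ker, Ideal.Quotient.eq_zero_iff_mem]

/-- Strong Nullstellensatz: a function vanishing at all `k`-valued points of `V(I)` lies in the
radical of `I`. -/
theorem mem_radical_of_forall_algHom {I : Ideal R} {f : R}
    (h : ∀ χ : R →ₐ[k] k, (∀ a ∈ I, χ a = 0) → χ f = 0) : f ∈ I.radical := by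
  have : IsJacobsonRing R := isJacobsonRing_of_finiteType (A := k)
  rw [Ideal.radical_eq_jacobson, Ideal.jacobson, Ideal.mem_sInf]
  rintro M ⟨hIM, hM⟩
  obtain ⟨χ, rfl⟩ := exists_algHom_of_isMaximal k M
  exact h χ fun a ha => hIM ha

end Nullstellensatz

/-! ### Dimension theory of affine domains -/

theorem MvPolynomial.height_of_isMaximal {k : Type*} [Field k] (s : ℕ)
    (M : Ideal (MvPolynomial (Fin s) k)) [hM : M.IsMaximal] : M.height = s := by
  induction s with
  | zero =>
    refine le_antisymm ?_ (by simp)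
    have h := Ideal.height_le_ringKrullDim_of_ne_top hM.ne_top
    rw [MvPolynomial.ringKrullDim_of_isNoetherianRing] at h
    simp only [ringKrullDim_eq_zero_of_field, Nat.card_eq_fintype_card, Fintype.card_fin] at h
    exact_mod_cast h
  | succ s ih =>
    let e := (MvPolynomial.finSuccEquiv k s).toRingEquiv
    let P : Ideal (Polynomial (MvPolynomial (Fin s) k)) := M.comap e.symm
    have hP : P.IsMaximal := Ideal.comap_isMaximal_of_equiv e.symm
    have hPM : P.height = M.height := RingEquiv.height_comap e.symm M
    let p := P.under (MvPolynomial (Fin s) k)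
    have hp : p.IsMaximal := Polynomial.isMaximal_comap_C_of_isJacobsonRing P
    have : P.LiesOver p := ⟨rfl⟩
    rw [← hPM, Polynomial.height_eq_height_add_one p P, ih p]
    simp

theorem ringKrullDim_le_of_isIntegral (R S : Type*) [CommRing R] [CommRing S] [Algebra R S]
    [Algebra.IsIntegral R S] : ringKrullDim S ≤ ringKrullDim R := by
  refine Order.krullDim_le_of_strictMono (PrimeSpectrum.comap (algebraMap R S)) ?_
  intro p q hpq
  obtain ⟨x, hxq, hxp⟩ := SetLike.exists_of_lt (show p.asIdeal < q.asIdeal from hpq)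
  exact Ideal.comap_lt_comap_of_integral_mem_sdiff hpq.le ⟨hxq, hxp⟩
    (Algebra.IsIntegral.isIntegral x)

/-- All maximal ideals of an affine domain have the same height. For a Noether normalization
`k[x₁, …, xₛ] ⊆ B`, going down holds because the polynomial ring is integrally closed, so a maximal
ideal of `B` has at least the height `s` of its contraction, while `dim B ≤ s` by integrality. -/
theorem Ideal.height_eq_ringKrullDim_of_isMaximal (k : Type*) [Field k] {B : Type*} [CommRing B]
    [IsDomain B] [Algebra k B] [Algebra.FiniteType k B] (M : Ideal B) [M.IsMaximal] :
    (M.height : WithBot ℕ∞) = ringKrullDim B := by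
  refine le_antisymm (Ideal.height_le_ringKrullDim_of_ne_top Ideal.IsPrime.ne_top') ?_
  obtain ⟨s, g, hg, hgi⟩ := exists_integral_inj_algHom_of_fg k B
  let := g.toRingHom.toAlgebra
  have : Algebra.IsIntegral (MvPolynomial (Fin s) k) B := ⟨hgi⟩
  have : FaithfulSMul (MvPolynomial (Fin s) k) B :=
    (faithfulSMul_iff_algebraMap_injective _ _).mpr hg
  have : IsNoetherianRing B := Algebra.FiniteType.isNoetherianRing k B
  let m := M.under (MvPolynomial (Fin s) k)
  have hm : m.IsMaximal := Ideal.isMaximal_comap_of_isIntegral_of_isMaximal M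
  have : M.LiesOver m := ⟨rfl⟩
  calc ringKrullDim B ≤ ringKrullDim (MvPolynomial (Fin s) k) := ringKrullDim_le_of_isIntegral _ _
    _ = (m.height : WithBot ℕ∞) := by
      rw [MvPolynomial.height_of_isMaximal s m, MvPolynomial.ringKrullDim_of_isNoetherianRing]
      simp
    _ ≤ M.height := by
      rw [Ideal.height_eq_height_add_of_liesOver_of_hasGoingDown m M]
      exact_mod_cast le_self_add

/-- Cutting an affine domain by one equation lowers the dimension by at most one: pick a maximal
ideal containing `b`, whose height is `dim B`, and apply Krull's height theorem to it. -/
theorem ringKrullDim_le_ringKrullDim_quotient_span_singleton_add_one (k : Type*) [Field k]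
    {B : Type*} [CommRing B] [IsDomain B] [Algebra k B] [Algebra.FiniteType k B] {b : B}
    (hb : ¬ IsUnit b) : ringKrullDim B ≤ ringKrullDim (B ⧸ Ideal.span {b}) + 1 := by
  have : IsNoetherianRing B := Algebra.FiniteType.isNoetherianRing k B
  obtain ⟨M, hM, hbM⟩ := exists_max_ideal_of_mem_nonunits hb
  rw [← Ideal.height_eq_ringKrullDim_of_isMaximal k M]
  refine (height_le_ringKrullDim_quotient_add_spanFinrank
    ((Ideal.span_singleton_le_iff_mem M).mpr hbM)).trans ?_
  gcongr
  exact_mod_cast (Submodule.spanFinrank_span_le_ncard_of_finite (Set.finite_singleton b)).trans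
    (Set.ncard_singleton b).le
  
theorem ringKrullDim_quotient_bot (R : Type*) [CommRing R] :
    ringKrullDim (R ⧸ (⊥ : Ideal R)) = ringKrullDim R :=
  ringKrullDim_eq_of_ringEquiv (RingEquiv.quotientBot R)

theorem ringKrullDim_ne_top_of_finiteType (k : Type*) [Field k] (B : Type*) [CommRing B]
    [Algebra k B] [Algebra.FiniteType k B] : ringKrullDim B ≠ ⊤ := by
  obtain ⟨n, f, hf⟩ := Algebra.FiniteType.iff_quotient_mvPolynomial''.mp ‹Algebra.FiniteType k B›
  refine ne_top_of_le_ne_top ?_ (ringKrullDim_le_of_surjective f.toRingHom hf)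
  rw [MvPolynomial.ringKrullDim_of_isNoetherianRing, ringKrullDim_eq_zero_of_field, zero_add]
  exact WithBot.coe_injective.ne (ENat.natCast_ne_top _)

/-! ### Points and coordinate rings of affine varieties -/

theorem AffSpace.isClosed_iff {k : Type*} [Field k] {n : ℕ} {V : Set (AffSpace k n)} :
    IsClosed V ↔ ∃ S : Set (MvPolynomial (Fin n) k), V = AffSpace.zeroSet S := by
  rw [← isOpen_compl_iff]
  change Vᶜᶜ ∈ {W | ∃ S : Set (MvPolynomial (Fin n) k), W = AffSpace.zeroSet S} ↔ _
  rw [compl_compl]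
  rfl

theorem isIrreducible_of_image_subtypeVal {T : Type*} [TopologicalSpace T] {Z : Set T} {V : Set Z}
    (hV : IsIrreducible (Subtype.val '' V)) : IsIrreducible V := by
  refine ⟨hV.nonempty.of_image, ?_⟩
  rintro _ _ ⟨u, hu, rfl⟩ ⟨w, hw, rfl⟩ ⟨x, hxV, hxu⟩ ⟨y, hyV, hyw⟩
  obtain ⟨_, ⟨z, hz, rfl⟩, hzuw⟩ :=
    hV.isPreirreducible u w hu hw ⟨x, ⟨x, hxV, rfl⟩, hxu⟩ ⟨y, ⟨y, hyV, rfl⟩, hyw⟩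
  exact ⟨z, hz, hzuw⟩

namespace AffineVariety

variable {k : Type*} [Field k] {m n : ℕ}

theorem aeval_coord_apply (X : AffineVariety k n) (p : MvPolynomial (Fin n) k) (x : X.Point) :
    MvPolynomial.aeval X.coord p x = MvPolynomial.eval x.1 p := by
  induction p using MvPolynomial.induction_on with
  | C a =>
    rw [MvPolynomial.aeval_C]
    exact (MvPolynomial.eval_C a).symm
  | add p q hp hq => rw [map_add, map_add, Pi.add_apply, hp, hq]
  | mul_X p i hp =>
    rw [map_mul, map_mul, Pi.mul_apply, hp, MvPolynomial.aeval_X]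
    exact congrArg _ (MvPolynomial.eval_X i).symm

instance finiteType_coordinateRing (X : AffineVariety k n) :
    Algebra.FiniteType k X.coordinateRing :=
  .of_surjective (MvPolynomial.aeval X.coord : MvPolynomial (Fin n) k →ₐ[k] _).rangeRestrict
    (AlgHom.rangeRestrict_surjective _)

/-- Evaluation of regular functions at a point of an affine variety. -/
noncomputable def evalAt (X : AffineVariety k n) (x : X.Point) : X.coordinateRing →ₐ[k] k :=
  (Pi.evalAlgHom k (fun _ : X.Point => k) x).comp X.coordinateRing.val

@[simp]
theorem evalAt_apply (X : AffineVariety k n) (x : X.Point) (f : X.coordinateRing) :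
    X.evalAt x f = f.1 x := rfl

/-- Every `k`-valued point of the coordinate ring is a point of the variety, because the variety
is Zariski closed in affine space. -/
theorem evalAt_surjective (X : AffineVariety k n) : Function.Surjective X.evalAt := by
  intro χ
  let a : Fin n → k := fun i => χ ⟨X.coord i, MvPolynomial.X i, by simp⟩
  have ha : ∀ p : MvPolynomial (Fin n) k,
      χ ⟨MvPolynomial.aeval X.coord p, p, rfl⟩ = MvPolynomial.eval a p := by
    intro p
    have h : χ.comp (MvPolynomial.aeval X.coord : MvPolynomial (Fin n) k →ₐ[k] _).rangeRestrict
        = MvPolynomial.aeval a := by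
      refine MvPolynomial.algHom_ext fun i => ?_
      rw [MvPolynomial.aeval_X]
      exact congrArg χ (Subtype.ext (MvPolynomial.aeval_X _ _))
    exact (DFunLike.congr_fun h p).trans (by rw [MvPolynomial.aeval_eq_eval])
  have haX : (a : AffSpace k n) ∈ X.carrier := by
    obtain ⟨S, hS⟩ := AffSpace.isClosed_iff.mp X.isClosed_carrier
    rw [hS]
    intro p hp
    refine (ha p).symm.trans ?_
    convert map_zero χ
    refine Subtype.ext (funext fun x => ?_)
    change MvPolynomial.aeval X.coord p x = 0
    rw [aeval_coord_apply]
    exact hS.subset x.2 p hp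
  refine ⟨⟨a, haX⟩, ?_⟩
  ext ⟨_, p, rfl⟩
  rw [evalAt_apply]
  exact (X.aeval_coord_apply p _).trans (ha p).symm

/-- The common zeros on `X` of an ideal of the coordinate ring. -/
def zeros (X : AffineVariety k n) (I : Ideal X.coordinateRing) : Set X.Point :=
  {x | ∀ f ∈ I, f.1 x = 0}

/-- The ideal of regular functions on `X` vanishing on a set of points. -/
noncomputable def vanishing (X : AffineVariety k n) (V : Set X.Point) : Ideal X.coordinateRing :=
  ⨅ x ∈ V, RingHom.ker (X.evalAt x)

theorem mem_vanishing {X : AffineVariety k n} {V : Set X.Point} {f : X.coordinateRing} :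
    f ∈ X.vanishing V ↔ ∀ x ∈ V, f.1 x = 0 := by
  simp [vanishing, Submodule.mem_iInf, RingHom.mem_ker]

theorem zeros_anti {X : AffineVariety k n} {I J : Ideal X.coordinateRing} (h : I ≤ J) :
    X.zeros J ⊆ X.zeros I := fun _ hx f hf => hx f (h hf)

theorem mem_zeros_span_singleton {X : AffineVariety k n} {f : X.coordinateRing} {x : X.Point} :
    x ∈ X.zeros (Ideal.span {f}) ↔ f.1 x = 0 := by
  constructor
  · exact fun hx => hx f (Ideal.mem_span_singleton_self f)
  · intro hx g hg
    obtain ⟨c, rfl⟩ := Ideal.mem_span_singleton.mp hg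
    change f.1 x * c.1 x = 0
    rw [hx, zero_mul]

theorem isClosed_zeros (X : AffineVariety k n) (I : Ideal X.coordinateRing) :
    IsClosed (X.zeros I) := by
  refine isClosed_induced_iff.mpr
    ⟨AffSpace.zeroSet {p | ⟨MvPolynomial.aeval X.coord p, p, rfl⟩ ∈ I},
      AffSpace.isClosed_iff.mpr ⟨_, rfl⟩, ?_⟩
  ext x
  constructor
  · rintro hx ⟨_, p, rfl⟩ hp
    exact (X.aeval_coord_apply p x).trans (hx p hp)
  · intro hx p hp
    exact (X.aeval_coord_apply p x).symm.trans (hx _ hp)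

/-- Every closed set of points is cut out by regular functions. -/
theorem zeros_vanishing {X : AffineVariety k n} {V : Set X.Point} (hV : IsClosed V) :
    X.zeros (X.vanishing V) = V := by
  refine Set.Subset.antisymm ?_ fun x hx f hf => mem_vanishing.mp hf x hx
  obtain ⟨W, hW, rfl⟩ := isClosed_induced_iff.mp hV
  obtain ⟨S, rfl⟩ := AffSpace.isClosed_iff.mp hW
  intro x hx p hp
  rw [← aeval_coord_apply]
  refine hx ⟨MvPolynomial.aeval X.coord p, p, rfl⟩ (mem_vanishing.mpr fun y hy => ?_)
  exact (X.aeval_coord_apply p y).trans (hy p hp)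

/-- Hilbert's Nullstellensatz on an affine variety. -/
theorem vanishing_zeros [IsAlgClosed k] (X : AffineVariety k n) (I : Ideal X.coordinateRing) :
    X.vanishing (X.zeros I) = I.radical := by
  refine le_antisymm (fun f hf => mem_radical_of_forall_algHom k fun χ hχ => ?_) ?_
  · obtain ⟨x, rfl⟩ := X.evalAt_surjective χ
    exact mem_vanishing.mp hf x hχ
  · rintro f ⟨N, hN⟩
    exact mem_vanishing.mpr fun x hx => eq_zero_of_pow_eq_zero (n := N) (hx _ hN)

instance irreducibleSpace_point (X : AffineVariety k n) : IrreducibleSpace X.Point :=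
  isIrreducible_iff_irreducibleSpace.mp X.isIrreducible_carrier

theorem isPrime_vanishing {X : AffineVariety k n} {V : Set X.Point} (hV : IsIrreducible V) :
    (X.vanishing V).IsPrime := by
  refine Ideal.isPrime_iff.mpr ⟨fun h => ?_, fun {f g} hfg => ?_⟩
  · obtain ⟨x, hx⟩ := hV.nonempty
    exact one_ne_zero (mem_vanishing.mp ((Ideal.eq_top_iff_one _).mp h) x hx)
  · simp only [mem_vanishing] at hfg ⊢
    have h := isPreirreducible_iff_isClosed_union_isClosed.mp hV.isPreirreducible
      (X.zeros (Ideal.span {f})) (X.zeros (Ideal.span {g})) (X.isClosed_zeros _)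
      (X.isClosed_zeros _) fun x hx => by
        simpa only [Set.mem_union, mem_zeros_span_singleton] using mul_eq_zero.mp (hfg x hx)
    exact h.imp (fun h x hx => mem_zeros_span_singleton.mp (h hx))
      (fun h x hx => mem_zeros_span_singleton.mp (h hx))

instance isDomain_coordinateRing (X : AffineVariety k n) : IsDomain X.coordinateRing := by
  have h := isPrime_vanishing (X := X) (V := Set.univ) (IrreducibleSpace.isIrreducible_univ _)
  have hbot : X.vanishing Set.univ = ⊥ := by
    refine le_bot_iff.mp fun f hf => ?_
    exact Subtype.ext (funext fun x => mem_vanishing.mp hf x trivial)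
  rw [hbot] at h
  exact IsDomain.of_bot_isPrime _

theorem isIrreducible_zeros [IsAlgClosed k] (X : AffineVariety k n) (P : Ideal X.coordinateRing)
    [hP : P.IsPrime] : IsIrreducible (X.zeros P) := by
  have hvan : X.vanishing (X.zeros P) = P := by rw [vanishing_zeros, hP.radical]
  constructor
  · by_contra hne
    rw [Set.not_nonempty_iff_eq_empty] at hne
    refine hP.ne_top ((Ideal.eq_top_iff_one _).mpr ?_)
    rw [← hvan, hne]
    exact mem_vanishing.mpr fun x hx => hx.elim
  · rw [isPreirreducible_iff_isClosed_union_isClosed]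
    intro V W hV hW hVW
    by_contra! hcon
    -- A closed set not containing `V(P)` lies in the zero set of some function outside `P`.
    have key : ∀ {V : Set X.Point}, IsClosed V → ¬ X.zeros P ⊆ V →
        ∃ f ∈ X.vanishing V, f ∉ P := by
      intro V hV h
      by_contra! hle
      exact h ((zeros_anti hle).trans (zeros_vanishing hV).subset)
    obtain ⟨f, hf, hfP⟩ := key hV hcon.1
    obtain ⟨g, hg, hgP⟩ := key hW hcon.2
    refine (hP.mem_or_mem (x := f) (y := g) ?_).elim hfP hgP
    rw [← hvan, mem_vanishing]
    intro x hx
    rw [mem_vanishing] at hf hg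
    exact mul_eq_zero.mpr ((hVW hx).imp (hf x) (hg x))

/-! ### Dimensions -/

/-- Taking vanishing ideals embeds the irreducible closed subsets of `X` into the spectrum of the
coordinate ring, reversing inclusions. -/
theorem topologicalKrullDim_point_le (X : AffineVariety k n) :
    topologicalKrullDim X.Point ≤ ringKrullDim X.coordinateRing := by
  rw [topologicalKrullDim, ringKrullDim,
    ← Order.krullDim_orderDual (α := PrimeSpectrum _)]
  let I : TopologicalSpace.IrreducibleCloseds X.Point → (PrimeSpectrum X.coordinateRing)ᵒᵈ :=
    fun V => OrderDual.toDual ⟨X.vanishing V, isPrime_vanishing V.isIrreducible⟩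
  refine Order.krullDim_le_of_strictMono I (Monotone.strictMono_of_injective ?_ ?_)
  · intro V W hVW f hf
    exact mem_vanishing.mpr fun x hx => mem_vanishing.mp hf x (hVW hx)
  · intro V W h
    have h' : X.vanishing V = X.vanishing W := congrArg (fun P => (OrderDual.ofDual P).asIdeal) h
    exact SetLike.coe_injective
      (by rw [← zeros_vanishing V.isClosed, h', zeros_vanishing W.isClosed])

/-- A set of points containing `V(I)` has at least the dimension of `A(X) / I`: a prime ideal over
`I` has an irreducible zero set inside `Z`, from which the prime can be recovered. -/
theorem ringKrullDim_quotient_le [IsAlgClosed k] (X : AffineVariety k n)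
    {I : Ideal X.coordinateRing} {Z : Set X.Point} (hIZ : X.zeros I ⊆ Z) :
    ringKrullDim (X.coordinateRing ⧸ I) ≤ topologicalKrullDim Z := by
  rw [topologicalKrullDim, ringKrullDim,
    ← Order.krullDim_orderDual (α := PrimeSpectrum _)]
  let q (P : (PrimeSpectrum (X.coordinateRing ⧸ I))ᵒᵈ) : Ideal X.coordinateRing :=
    (OrderDual.ofDual P).asIdeal.comap (Ideal.Quotient.mk I)
  have hqI : ∀ P, X.zeros (q P) ⊆ Z := fun P =>
    (zeros_anti fun f hf => by
      simp [q, Ideal.mem_comap, Ideal.Quotient.eq_zero_iff_mem.mpr hf]).trans hIZ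
  have hval : ∀ P, Subtype.val '' (Subtype.val ⁻¹' X.zeros (q P) : Set Z) = X.zeros (q P) :=
    fun P => Set.image_preimage_eq_of_subset (by simpa using hqI P)
  let F : (PrimeSpectrum (X.coordinateRing ⧸ I))ᵒᵈ → TopologicalSpace.IrreducibleCloseds Z :=
    fun P => ⟨Subtype.val ⁻¹' X.zeros (q P),
      isIrreducible_of_image_subtypeVal
        (by rw [hval]; exact X.isIrreducible_zeros _),
      (X.isClosed_zeros _).preimage continuous_subtype_val⟩
  refine Order.krullDim_le_of_strictMono F (Monotone.strictMono_of_injective ?_ ?_)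
  · intro P Q hPQ x hx
    exact zeros_anti (Ideal.comap_mono (show (OrderDual.ofDual Q).asIdeal ≤ _ from hPQ)) hx
  · intro P Q h
    have h1 : X.zeros (q P) = X.zeros (q Q) := by
      rw [← hval P, ← hval Q]
      exact congrArg (fun V : TopologicalSpace.IrreducibleCloseds Z => Subtype.val '' (V : Set Z)) h
    have h2 : q P = q Q := by
      have h3 := congrArg X.vanishing h1
      simp only [vanishing_zeros] at h3
      rwa [(inferInstance : (q P).IsPrime).radical, (inferInstance : (q Q).IsPrime).radical] at h3
    have h4 := Ideal.comap_injective_of_surjective _ Ideal.Quotient.mk_surjective h2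
    exact OrderDual.ofDual.injective (PrimeSpectrum.ext h4)

end AffineVariety

/-! ### Elements that are constant along the fibres of an extension of domains -/

section Fibres

variable {B A : Type*} [CommRing B] [CommRing A] [Algebra B A]

/-- If `g` takes the same value at any two `k`-points of `A` lying over the same point of `B`, then
`g ⊗ 1 - 1 ⊗ g` vanishes at all `k`-points of `A ⊗[B] A`, hence is nilpotent. -/
theorem isNilpotent_tmul_sub_of_forall_algHom (k : Type*) [Field k] [IsAlgClosed k] [Algebra k B]
    [Algebra k A] [IsScalarTower k B A] [Algebra.FiniteType k A] {g : A}
    (hg : ∀ χ₁ χ₂ : A →ₐ[k] k, (∀ b : B, χ₁ (algebraMap B A b) = χ₂ (algebraMap B A b)) →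
      χ₁ g = χ₂ g) :
    IsNilpotent (g ⊗ₜ[B] (1 : A) - 1 ⊗ₜ[B] g) := by
  have : Algebra.FiniteType B A := .of_restrictScalars_finiteType k B A
  have : Algebra.FiniteType k (A ⊗[B] A) := .trans (S := A) ‹_› inferInstance
  rw [← mem_nilradical, nilradical]
  refine mem_radical_of_forall_algHom k fun χ _ => ?_
  have h := hg (χ.comp Algebra.TensorProduct.includeLeft)
    (χ.comp (Algebra.TensorProduct.includeRight.restrictScalars k)) fun b => by
      simp [Algebra.TensorProduct.tmul_one_eq_one_tmul]
  simpa [sub_eq_zero] using h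

/-- If the two images of `g` in `A ⊗[B] A` agree up to a nilpotent, then `g` is a fraction of
elements of `B`, which can be taken in lowest terms because `B` is factorial. -/
theorem exists_isRelPrime_of_isNilpotent_tmul_sub [IsDomain B] [UniqueFactorizationMonoid B]
    [CharZero B] [IsDomain A] [FaithfulSMul B A] {g : A}
    (hg : IsNilpotent (g ⊗ₜ[B] (1 : A) - 1 ⊗ₜ[B] g)) :
    ∃ p q : B, IsRelPrime p q ∧ algebraMap B A q * g = algebraMap B A p := by
  let K := FractionRing B
  let L := FractionRing A
  have : FaithfulSMul B L := .trans B A L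
  let : Algebra K L := FractionRing.liftAlgebra B L
  have : IsScalarTower B K L := FractionRing.isScalarTower_liftAlgebra B L
  have : CharZero K := charZero_of_injective_algebraMap (IsFractionRing.injective B K)
  let ι : A →ₐ[B] L := IsScalarTower.toAlgHom B A L
  let F : A ⊗[B] A →ₐ[B] L ⊗[K] L := Algebra.TensorProduct.productMap
    (((Algebra.TensorProduct.includeLeft : L →ₐ[K] L ⊗[K] L).restrictScalars B).comp ι)
    (((Algebra.TensorProduct.includeRight : L →ₐ[K] L ⊗[K] L).restrictScalars B).comp ι)
  have hF := hg.map F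
  simp only [F, map_sub, Algebra.TensorProduct.productMap_apply_tmul, map_one, mul_one,
    one_mul] at hF
  obtain ⟨x, hx⟩ := mem_range_of_isNilpotent_tmul_sub (K := K) (x := algebraMap A L g) hF
  obtain ⟨p, q, hpq, rfl⟩ := IsFractionRing.exists_reduced_fraction B x
  refine ⟨p, q, hpq, IsFractionRing.injective A L ?_⟩
  rw [map_mul, ← hx, ← IsScalarTower.algebraMap_apply, ← IsScalarTower.algebraMap_apply,
    IsScalarTower.algebraMap_apply B K L, ← map_mul, mul_comm, IsLocalization.mk'_spec,
    ← IsScalarTower.algebraMap_apply]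

end Fibres

/-! ### Almost surjective regular maps -/

namespace AffineVariety.RegularMap

variable {k : Type*} [Field k] [IsAlgClosed k] {m n : ℕ} {X : AffineVariety k m}
  {Y : AffineVariety k n} {Φ : RegularMap X Y}

/-- The closure of the complement of the image of an almost surjective map contains no zero set of
codimension at most one. -/
theorem IsAlmostSurjective.not_zeros_subset (hΦ : Φ.IsAlmostSurjective)
    {I : Ideal Y.coordinateRing}
    (hI : ringKrullDim Y.coordinateRing ≤ ringKrullDim (Y.coordinateRing ⧸ I) + 1) :
    ¬ Y.zeros I ⊆ closure (Set.range Φ.toFun)ᶜ := by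
  intro hsub
  have h2 : ringKrullDim (Y.coordinateRing ⧸ I) + 2 ≤ ringKrullDim Y.coordinateRing :=
    (add_le_add_left (Y.ringKrullDim_quotient_le hsub) 2).trans
      (hΦ.trans Y.topologicalKrullDim_point_le)
  have htop := ringKrullDim_ne_top_of_finiteType k Y.coordinateRing
  have hbot : ringKrullDim Y.coordinateRing ≠ ⊥ :=
    ((WithBot.bot_lt_coe 0).trans_le ringKrullDim_nonneg_of_nontrivial).ne'
  generalize ringKrullDim Y.coordinateRing = d at *
  generalize ringKrullDim (Y.coordinateRing ⧸ I) = e at *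
  induction d with
  | bot => exact hbot rfl
  | coe d =>
  induction e with
  | bot => simp at hI
  | coe e =>
  induction d with
  | top => exact htop rfl
  | coe d =>
  induction e with
  | top => exact htop (top_le_iff.mp h2)
  | coe e =>
  have hI' : d ≤ e + 1 := by exact_mod_cast hI
  rw [← one_add_one_eq_two, ← add_assoc] at h2
  have h2' : e + 1 + 1 ≤ d := by exact_mod_cast h2
  omega

/-- A nonzero `b` with `b ∘ Φ = 0` would put the dense open set `{b ≠ 0}` into the complement of the
image, whose closure would then be all of `Y`. -/
theorem IsAlmostSurjective.pullback_injective (hΦ : Φ.IsAlmostSurjective) :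
    Function.Injective Φ.pullback := by
  rw [injective_iff_map_eq_zero]
  intro b hb
  by_contra hb0
  have hopen : IsOpen (Y.zeros (Ideal.span {b}))ᶜ := (Y.isClosed_zeros _).isOpen_compl
  have hne : (Y.zeros (Ideal.span {b}))ᶜ.Nonempty := by
    by_contra! h
    refine hb0 (Subtype.ext (funext fun y => ?_))
    exact mem_zeros_span_singleton.mp (Set.compl_empty_iff.mp h ▸ Set.mem_univ y)
  have hsub : (Y.zeros (Ideal.span {b}))ᶜ ⊆ (Set.range Φ.toFun)ᶜ := by
    rw [Set.compl_subset_compl]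
    rintro _ ⟨x, rfl⟩
    exact mem_zeros_span_singleton.mpr (congrFun (congrArg Subtype.val hb) x)
  have hdense : closure (Set.range Φ.toFun)ᶜ = Set.univ :=
    ((hopen.dense hne).mono hsub).closure_eq
  refine hΦ.not_zeros_subset (I := ⊥) ?_ (hdense ▸ Set.subset_univ _)
  rw [ringKrullDim_quotient_bot]
  exact le_add_of_nonneg_right zero_le_one

/-- A prime element `π` divides every regular function that vanishes at the points of `V(π)` in the
image of an almost surjective map: these points are dense in `V(π)`, a set of codimension one. -/
theorem IsAlmostSurjective.dvd_of_forall_range (hΦ : Φ.IsAlmostSurjective) {π p : Y.coordinateRing}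
    (hπ : Prime π) (h : ∀ x, π.1 (Φ.toFun x) = 0 → p.1 (Φ.toFun x) = 0) : π ∣ p := by
  have hP : (Ideal.span {π}).IsPrime := (Ideal.span_singleton_prime hπ.ne_zero).mpr hπ
  have hcover : Y.zeros (Ideal.span {π}) ⊆
      closure (Set.range Φ.toFun)ᶜ ∪ Y.zeros (Ideal.span {p}) := by
    intro y hy
    by_cases hyΦ : y ∈ Set.range Φ.toFun
    · obtain ⟨x, rfl⟩ := hyΦ
      exact Or.inr (mem_zeros_span_singleton.mpr (h x (mem_zeros_span_singleton.mp hy)))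
    · exact Or.inl (subset_closure hyΦ)
  rcases isPreirreducible_iff_isClosed_union_isClosed.mp
    (Y.isIrreducible_zeros (Ideal.span {π})).isPreirreducible _ _ isClosed_closure
    (Y.isClosed_zeros _) hcover with hZ | hp
  · exact absurd hZ (hΦ.not_zeros_subset
      (ringKrullDim_le_ringKrullDim_quotient_span_singleton_add_one k hπ.not_isUnit))
  · rw [← Ideal.mem_span_singleton, ← hP.radical, ← vanishing_zeros]
    exact mem_vanishing.mpr fun y hy => mem_zeros_span_singleton.mp (hp hy)

/-- A regular function on `X` that is determined by `Φ` is a rational function on `Y`, written in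
lowest terms. -/
theorem exists_isRelPrime_of_mem_determinedSubalgebra [CharZero k]
    [UniqueFactorizationMonoid Y.coordinateRing] (hΦ : Function.Injective Φ.pullback)
    {g : X.coordinateRing} (hg : g ∈ Φ.determinedSubalgebra) :
    ∃ p q : Y.coordinateRing, IsRelPrime p q ∧ Φ.pullback q * g = Φ.pullback p := by
  let := Φ.pullback.toRingHom.toAlgebra
  have : IsScalarTower k Y.coordinateRing X.coordinateRing := .of_algHom Φ.pullback
  have : FaithfulSMul Y.coordinateRing X.coordinateRing :=
    (faithfulSMul_iff_algebraMap_injective _ _).mpr hΦ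
  have : CharZero Y.coordinateRing := algebraRat.charZero _
  refine exists_isRelPrime_of_isNilpotent_tmul_sub
    (isNilpotent_tmul_sub_of_forall_algHom k fun χ₁ χ₂ hχ => ?_)
  obtain ⟨x₁, rfl⟩ := X.evalAt_surjective χ₁
  obtain ⟨x₂, rfl⟩ := X.evalAt_surjective χ₂
  obtain ⟨h, hh⟩ := hg
  have hx : Φ.toFun x₁ = Φ.toFun x₂ :=
    Subtype.ext (funext fun i => hχ ⟨Y.coord i, MvPolynomial.X i, MvPolynomial.aeval_X _ _⟩)
  rw [evalAt_apply, evalAt_apply, ← hh, Function.comp_apply, Function.comp_apply, hx]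

end AffineVariety.RegularMap

theorem mainTheorem1 {k : Type*} [Field k] [IsAlgClosed k] [CharZero k] {m n : ℕ}
    (X : AffineVariety k m) (Y : AffineVariety k n) (hY : Y.IsFactorial)
    (Φ : AffineVariety.RegularMap X Y) (hΦ : Φ.IsAlmostSurjective) :
    Φ.determinedSubalgebra = Φ.pullbackSubalgebra := by
  have := hY.2
  refine le_antisymm (fun g hg => ?_) ?_
  · obtain ⟨p, q, hpq, hg'⟩ := AffineVariety.RegularMap.exists_isRelPrime_of_mem_determinedSubalgebra
      hΦ.pullback_injective hg
    have hval : ∀ x, q.1 (Φ.toFun x) * g.1 x = p.1 (Φ.toFun x) :=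
      fun x => congrFun (congrArg Subtype.val hg') x
    have hq : IsUnit q := by
      by_contra hq
      have hq0 : q ≠ 0 := by
        rintro rfl
        have hp0 : p = 0 := hΦ.pullback_injective (by rw [← hg', map_zero, zero_mul])
        exact hq (hpq (hp0.symm.dvd) dvd_rfl)
      obtain ⟨π, hπ, hπq⟩ := WfDvdMonoid.exists_irreducible_factor hq hq0
      refine hπ.not_isUnit (hpq (hΦ.dvd_of_forall_range hπ.prime fun x hx => ?_) hπq)
      obtain ⟨c, rfl⟩ := hπq
      rw [← hval x]
      change π.1 _ * c.1 _ * _ = 0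
      rw [hx, zero_mul, zero_mul]
    obtain ⟨u, rfl⟩ := hq
    refine ⟨↑u⁻¹ * p, ?_⟩
    change Φ.pullback (↑u⁻¹ * p) = g
    rw [map_mul, ← hg', ← mul_assoc, ← map_mul, Units.inv_mul, map_one, one_mul]
  · rintro _ ⟨f, rfl⟩
    exact ⟨f.1, rfl⟩
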